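/- Let $K$ be a field with $\operatorname{char} K \neq 2,3$, let $K^{\mathrm{sep}}$ be a separable closure of $K$, and let $G_K=\operatorname{Gal}(K^{\mathrm{sep}}/K)$ with the Krull topology. Let $M$ be a (discrete) $K$-Galois module of order $3$, i.e. an abelian group of order $3$ with a continuous action of $G_K$ by automorphisms. Let $M'=\operatorname{Hom}(M,\mu_3)$ be its Tate dual, with action $(gf)(x)=g(f(g^{-1}x))$. Let $T'$ be the quadratic étale $K$-algebra corresponding to $M'$: that is, an étale $K$-algebra with a $G_K$-equivariant bijection $\iota\mapsto f_\iota$ from its set of coordinates $C=\operatorname{Hom}_{K\text{-alg}}(T',K^{\mathrm{sep}})$ to the set of elements of maximal order (i.e. the nonzero elements) of $M'$. Embed $T'$ in $(K^{\mathrm{sep}})^2=(K^{\mathrm{sep}})^{C}$ by its coordinates, write $T'^{N=1}$ for the group of units of $T'$ of norm $1$ over $K$, and let $$\Omega=\big((K^{\mathrm{sep}})^2\big)^{N=1}[3]=\{\omega\in (K^{\mathrm{sep}})^{C} : \omega^3=1,\ N(\omega)=1\}.$$ Then $x\mapsto\omega_x:=(f_\iota(x))_{\iota\in C}$ is a bijection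 $M\to\Omega$, and there is a group isomorphism $$H^1(K,M)\;\cong\; T'^{N=1}/(T'^{N=1})^3$$ ($H^1$ being continuous $1$-cocycles modulo coboundaries) with the following property. Let $\delta\in T'^{N=1}$. There exists $\theta=\sqrt[3]{\delta}\in (K^{\mathrm{sep}})^2$ with $\theta^3=\delta$ and $N(\theta)=1$, and for every such $\theta$ the image $L$ of the $K$-linear map $$\kappa: K\times T'\to (K^{\mathrm{sep}})^{\Omega},\qquad (a,\xi)\mapsto \big(a+\operatorname{tr}_{(K^{\mathrm{sep}})^2/K^{\mathrm{sep}}}(\xi\,\omega\,\theta)\big)_{\omega\in\Omega}$$ is a cubic étale $K$-subalgebra of $(K^{\mathrm{sep}})^{\Omega}\cong (K^{\mathrm{sep}})^3$ whose coordinates are exactly the three distinct projections $\pi_x:y\mapsto y_{\omega_x}$, $x\in M$. The class of $\delta$ corresponds to $L$ in the following sense: for every continuous cocycle $\sigma:G_K\to M$, the isomorphism sends $[\sigma]$ to the class of $\delta$ if and only if there is $t\in M$ such that the labelling $\iota_x=\pi_{x+t}$ $(x\in M)$ of the coordinates of $L$ satisfies $$g\circ\iota_x=\iota_{gx+\sigma(g)}\qquad\text{for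 all } g\in G_K,\ x\in M.$$ -/

import Mathlib

namespace KummerCubic

noncomputable section

/-! ## Galois cohomology in degree one, by continuous inhomogeneous cochains -/

/-- `Z¹(G, M)`: continuous crossed homomorphisms `σ : G → M`,
`σ (g h) = σ g + g • σ h`, under pointwise addition. -/
def Z1 (G M : Type*) [Group G] [TopologicalSpace G] [AddCommGroup M] [TopologicalSpace M]
    [IsTopologicalAddGroup M] [DistribMulAction G M] : AddSubgroup (G → M) where
  carrier := {σ | Continuous σ ∧ ∀ g h : G, σ (g * h) = σ g + g • σ h}
  zero_mem' := ⟨continuous_const, fun g h => by simp⟩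
  add_mem' := by
    rintro a b ⟨ha, ha'⟩ ⟨hb, hb'⟩
    refine ⟨ha.add hb, fun g h => ?_⟩
    simp only [Pi.add_apply, ha', hb', smul_add]
    abel
  neg_mem' := by
    rintro a ⟨ha, ha'⟩
    refine ⟨ha.neg, fun g h => ?_⟩
    simp only [Pi.neg_apply, ha', smul_neg]
    abel

/-- `B¹(G, M)`: the coboundaries `g ↦ g • u - u`, as a subgroup of `Z¹(G, M)`. -/
def B1 (G M : Type*) [Group G] [TopologicalSpace G] [AddCommGroup M] [TopologicalSpace M]
    [IsTopologicalAddGroup M] [DistribMulAction G M] : AddSubgroup (Z1 G M) where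
  carrier := {σ | ∃ u : M, ∀ g : G, (σ : G → M) g = g • u - u}
  zero_mem' := ⟨0, fun g => by simp⟩
  add_mem' := by
    rintro a b ⟨u, hu⟩ ⟨v, hv⟩
    refine ⟨u + v, fun g => ?_⟩
    simp only [AddSubgroup.coe_add, Pi.add_apply, hu, hv, smul_add]
    abel
  neg_mem' := by
    rintro a ⟨u, hu⟩
    refine ⟨-u, fun g => ?_⟩
    simp only [AddSubgroup.coe_neg, Pi.neg_apply, hu, smul_neg]
    abel

/-- `H¹(G, M) = Z¹(G, M) / B¹(G, M)`. -/
abbrev H1 (G M : Type*) [Group G] [TopologicalSpace G] [AddCommGroup M] [TopologicalSpace M]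
    [IsTopologicalAddGroup M] [DistribMulAction G M] : Type _ :=
  Z1 G M ⧸ B1 G M

/-! ## The Tate dual -/

/-- The Tate dual `M' = Hom(M, μ_m)`, where `m` is the exponent of `M` and
`μ_m` is the group of `m`-th roots of unity in `Ks`. -/
def TateDual (Ks M : Type*) [Field Ks] [AddCommGroup M] : Type _ :=
  M →+ Additive (rootsOfUnity (AddMonoid.exponent M) Ks)

instance (Ks M : Type*) [Field Ks] [AddCommGroup M] : AddCommGroup (TateDual Ks M) :=
  inferInstanceAs (AddCommGroup (M →+ Additive (rootsOfUnity (AddMonoid.exponent M) Ks)))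

/-- The value `f x ∈ μ_m ⊆ Ks` of `f ∈ M'` at `x ∈ M`. -/
def TateDual.eval {Ks M : Type*} [Field Ks] [AddCommGroup M] (f : TateDual Ks M) (x : M) : Ks :=
  ((Additive.toMul ((show M →+ Additive (rootsOfUnity (AddMonoid.exponent M) Ks) from f) x) :
    rootsOfUnity (AddMonoid.exponent M) Ks) : Ksˣ)

/-- The Galois action on the Tate dual, `(g f)(x) = g (f (g⁻¹ x))`. -/
instance (K Ks M : Type*) [Field K] [Field Ks] [Algebra K Ks] [AddCommGroup M]
    [DistribMulAction Gal(Ks/K) M] : SMul Gal(Ks/K) (TateDual Ks M) where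
  smul g f := (MonoidHom.toAdditive (restrictRootsOfUnity g (AddMonoid.exponent M))).comp
    (AddMonoidHom.comp (show M →+ Additive (rootsOfUnity (AddMonoid.exponent M) Ks) from f)
      (DistribSMul.toAddMonoidHom M g⁻¹))

theorem TateDual.eval_smul {K Ks M : Type*} [Field K] [Field Ks] [Algebra K Ks] [AddCommGroup M]
    [DistribMulAction Gal(Ks/K) M] (g : Gal(Ks/K)) (f : TateDual Ks M) (x : M) :
    (g • f).eval x = g (f.eval (g⁻¹ • x)) := rfl

/-- `M⁻`: the elements of maximal order in a finite abelian group `M`,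
that is, those whose order is the exponent of `M`. -/
def MaxOrder (M : Type*) [AddCommGroup M] : Type _ :=
  {x : M // addOrderOf x = AddMonoid.exponent M}

/-! ## Étale algebras and their coordinates -/

/-- The coordinates of a `K`-algebra `L`: its `K`-algebra maps to `Ks`. -/
abbrev Coord (K Ks L : Type*) [Field K] [Field Ks] [Algebra K Ks] [CommRing L] [Algebra K L] :
    Type _ :=
  L →ₐ[K] Ks

/-- The Galois action on coordinates, `(g ι)(x) = g (ι x)`. -/
def galCoord {K Ks L : Type*} [Field K] [Field Ks] [Algebra K Ks] [CommRing L] [Algebra K L]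
    (g : Gal(Ks/K)) (ι : Coord K Ks L) : Coord K Ks L :=
  (g : Ks →ₐ[K] Ks).comp ι

/-- The Minkowski embedding `L → Ksⁿ`, the coordinates of `Ksⁿ` being indexed by those of `L`. -/
def minkowski (K Ks L : Type*) [Field K] [Field Ks] [Algebra K Ks] [CommRing L] [Algebra K L] :
    L →ₐ[K] (Coord K Ks L → Ks) :=
  AlgHom.pi (fun ι => ι)

/-- The labelling `x ↦ ι_x` of the coordinates of `L` by the elements of `M` exhibits `L` as the
algebra attached to the cocycle `σ`: `g ∘ ι_x = ι_{g x + σ(g)}` for all `g`, `x`. -/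
def IsLabelling {K Ks M L : Type*} [Field K] [Field Ks] [Algebra K Ks] [AddCommGroup M]
    [DistribMulAction Gal(Ks/K) M] [CommRing L] [Algebra K L]
    (σ : Gal(Ks/K) → M) (ι : M ≃ Coord K Ks L) : Prop :=
  ∀ (g : Gal(Ks/K)) (x : M), galCoord g (ι x) = ι (g • x + σ g)

/-! ## Norm-one elements and the map `κ` -/

/-- `T^{N=1}`: the group of units of norm `1` of a `K`-algebra `T`. -/
abbrev NormOne (K T : Type*) [Field K] [CommRing T] [Algebra K T] : Subgroup Tˣ :=
  (Units.map (Algebra.norm K : T →* K)).ker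

/-- `T^{N=1} / (T^{N=1})³`. -/
abbrev NormOneModCubes (K T : Type*) [Field K] [CommRing T] [Algebra K T] : Type _ :=
  NormOne K T ⧸ (powMonoidHom 3 : NormOne K T →* NormOne K T).range

/-- `(Ks²)^{N=1}[3]`: the cube roots of `1` of norm `1` in the `Ks`-algebra of functions `C → Ks`
(where `C` will be the two-element set of coordinates of a quadratic algebra). -/
def Omega (Ks C : Type*) [Field Ks] : Type _ :=
  {ω : C → Ks // ω ^ 3 = 1 ∧ Algebra.norm Ks ω = 1}

/-- The `K`-linear map `κ : K × T → Ks³`, `(a, ξ) ↦ (a + tr_{Ks²/Ks} (ξ ω θ))_ω`, where `θ ∈ Ks²`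
is a cube root of `δ`, the algebra `T` is embedded in `Ks²` by its two coordinates,
and `ω` runs through `(Ks²)^{N=1}[3]`. -/
def kappa (K Ks T : Type*) [Field K] [Field Ks] [Algebra K Ks] [CommRing T] [Algebra K T]
    (θ : Coord K Ks T → Ks) : (K × T) →ₗ[K] (Omega Ks (Coord K Ks T) → Ks) where
  toFun p := fun ω => algebraMap K Ks p.1 +
    Algebra.trace Ks (Coord K Ks T → Ks) (minkowski K Ks T p.2 * ω.1 * θ)
  map_add' p q := by
    funext ω
    simp only [Prod.fst_add, Prod.snd_add, map_add, add_mul, Pi.add_apply]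
    abel
  map_smul' c p := by
    funext ω
    have h : minkowski K Ks T (c • p.2) * ω.1 * θ
        = algebraMap K Ks c • (minkowski K Ks T p.2 * ω.1 * θ) := by
      rw [map_smul, algebraMap_smul, smul_mul_assoc, smul_mul_assoc]
    have h' : algebraMap K Ks (c • p.1) = algebraMap K Ks c • algebraMap K Ks p.1 := by
      rw [smul_eq_mul, smul_eq_mul, map_mul]
    change algebraMap K Ks (c • p.1) + Algebra.trace Ks _ (minkowski K Ks T (c • p.2) * ω.1 * θ)
      = c • (algebraMap K Ks p.1 + Algebra.trace Ks _ (minkowski K Ks T p.2 * ω.1 * θ))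
    rw [h, h', map_smul, ← smul_add, algebraMap_smul]

end

end KummerCubic

/-!
The nonzero elements of the Tate dual of `M` are the two nontrivial characters of `M` with values in
`Ks`, so the coordinates of `T'` enumerate these characters compatibly with the Galois actions. A
cube root `θ` of `δ` of norm one is moved by `g` to another one, hence is multiplied by the values
at some `c g ∈ M` of the two characters, and `c` is a cocycle. This relation between cocycles and
elements of norm one is a subgroup of `Z¹ × T'^{N=1}`, and Goursat's lemma turns it into the
isomorphism. Every cocycle occurs by Hilbert 90: if `η` is a nowhere vanishing Lagrange resolvent
for `c`, then `N(η) η⁻²` has norm one and again cocycle `c`, because `3 c = 0`.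

By Galois descent, the cubic algebra of `c` is the algebra of functions `M → Ks` equivariant for the
affine action `x ↦ g x + c g`. On the group `M` of order three, Fourier inversion writes such a
function `y` as `3 y = a + ∑ χ, ŷ(χ) χ` with `a ∈ K`. Its coefficients `ŷ(χ)` transform like `θ`, so
their quotients by `θ` come from `T'`; this is exactly the parametrisation `κ`.
-/

namespace KummerCubic

section BaseChange

open scoped TensorProduct

variable {R S A B : Type*} [CommRing R] [CommRing S] [CommRing A] [CommRing B] [Algebra R S]
  [Algebra R A] [Algebra R B] [Algebra S B] [IsScalarTower R S B] {f : A →ₐ[R] B}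

theorem norm_apply_of_isBaseChange [Module.Free R A] [Module.Finite R A]
    (hf : IsBaseChange S f.toLinearMap) (a : A) :
    Algebra.norm S (f a) = algebraMap R S (Algebra.norm R a) := by
  classical
  let b := Module.Free.chooseBasis R A
  have hmatrix : Algebra.leftMulMatrix (hf.basis b) (f a)
      = (Algebra.leftMulMatrix b a).map (algebraMap R S) := by
    ext i j
    rw [Matrix.map_apply, Algebra.leftMulMatrix_eq_repr_mul, Algebra.leftMulMatrix_eq_repr_mul,
      hf.basis_apply, ← hf.basis_repr_comp_apply, AlgHom.toLinearMap_apply,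
      AlgHom.toLinearMap_apply, map_mul f]
  rw [Algebra.norm_eq_matrix_det (hf.basis b), hmatrix, Algebra.norm_eq_matrix_det b,
    RingHom.map_det, RingHom.mapMatrix_apply]

theorem injective_of_isBaseChange [Module.Free R A] [FaithfulSMul R S]
    (hf : IsBaseChange S f.toLinearMap) : Function.Injective f := by
  let b := Module.Free.chooseBasis R A
  refine (injective_iff_map_eq_zero f).mpr fun a ha => b.ext_elem fun i => ?_
  refine FaithfulSMul.algebraMap_injective R S ?_
  rw [← hf.basis_repr_comp_apply, AlgHom.toLinearMap_apply, ha]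
  simp only [map_zero, Finsupp.zero_apply]

theorem finrank_eq_of_isBaseChange [StrongRankCondition R] [StrongRankCondition S] [Module.Free R A]
    (hf : IsBaseChange S f.toLinearMap) : Module.finrank S B = Module.finrank R A := by
  rw [← hf.equiv.finrank_eq, Module.finrank_baseChange]

theorem bijective_lift_of_isBaseChange (hf : IsBaseChange S f.toLinearMap) :
    Function.Bijective
      (Algebra.TensorProduct.lift (Algebra.ofId S B) f fun _ _ => .all _ _ : S ⊗[R] A →ₐ[S] B) := by
  have h : (Algebra.TensorProduct.lift (Algebra.ofId S B) f fun _ _ => .all _ _).toLinearMap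
      = hf.equiv.toLinearMap := by
    ext
    simp [hf.equiv_tmul]
  rw [← AlgHom.coe_toLinearMap, h]
  exact hf.equiv.bijective

theorem isBaseChange_of_bijective_lift
    (hf : Function.Bijective
      (Algebra.TensorProduct.lift (Algebra.ofId S B) f fun _ _ => .all _ _ : S ⊗[R] A →ₐ[S] B)) :
    IsBaseChange S f.toLinearMap :=
  .of_equiv (AlgEquiv.ofBijective _ hf).toLinearEquiv fun a => by simp

theorem etale_of_isBaseChange [Module.FaithfullyFlat R S] [Algebra.Etale S B]
    (hf : IsBaseChange S f.toLinearMap) : Algebra.Etale R A :=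
  have := Algebra.Etale.of_equiv (AlgEquiv.ofBijective _ (bijective_lift_of_isBaseChange hf)).symm
  .of_etale_tensorProduct_of_faithfullyFlat S

theorem isBaseChange_of_basis {I : Type*} (b : Module.Basis I R A) (b' : Module.Basis I S B)
    (h : ∀ i, f (b i) = b' i) : IsBaseChange S f.toLinearMap := by
  have he : ((b.baseChange S).equiv b' (.refl I)).toLinearMap.restrictScalars R ∘ₗ
      TensorProduct.mk R S A 1 = f.toLinearMap :=
    b.ext fun i => by
      have := (b.baseChange S).equiv_apply i b' (.refl I)
      simp_all
  exact .of_equiv ((b.baseChange S).equiv b' (.refl I)) (DFunLike.congr_fun he)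

end BaseChange

section GaloisSets

variable {K Ks X : Type*} [Field K] [Field Ks] [Algebra K Ks]

/-- The `K`-algebra of Galois-equivariant functions `X → Ks`, for an action `α` of the absolute
Galois group on a set `X`. For finite `X` and continuous `α` this is the étale algebra which
Grothendieck's form of Galois theory attaches to `X`. -/
def equivariantFunctions (α : Gal(Ks/K) →* Equiv.Perm X) : Subalgebra K (X → Ks) where
  carrier := {y | ∀ g x, g (y x) = y (α g x)}
  mul_mem' hy hz g x := by rw [Pi.mul_apply, map_mul, hy, hz, Pi.mul_apply]
  add_mem' hy hz g x := by rw [Pi.add_apply, map_add, hy, hz, Pi.add_apply]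
  algebraMap_mem' a g _ := g.commutes a

variable {α : Gal(Ks/K) →* Equiv.Perm X}

/-- The stabilizer of a point for the action `α`. -/
def pointStabilizer (α : Gal(Ks/K) →* Equiv.Perm X) (x : X) : Subgroup Gal(Ks/K) :=
  (MulAction.stabilizer (Equiv.Perm X) x).comap α

theorem mem_pointStabilizer {x : X} {g : Gal(Ks/K)} : g ∈ pointStabilizer α x ↔ α g x = x :=
  Iff.rfl

theorem apply_eq_apply_iff_inv_mul_mem_pointStabilizer {x : X} {g h : Gal(Ks/K)} :
    α g x = α h x ↔ h⁻¹ * g ∈ pointStabilizer α x := by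
  rw [mem_pointStabilizer, map_mul, map_inv, Equiv.Perm.mul_apply, Equiv.Perm.inv_eq_iff_eq]

theorem mem_equivariantFunctions {y : X → Ks} :
    y ∈ equivariantFunctions α ↔ ∀ g x, g (y x) = y (α g x) := Iff.rfl

theorem exists_mem_equivariantFunctions_apply_eq {x : X} {a : Ks}
    (ha : a ∈ IntermediateField.fixedField (pointStabilizer α x)) :
    ∃ y ∈ equivariantFunctions α, (∀ g, y (α g x) = g a) ∧ ∀ x', (∀ g, α g x ≠ x') → y x' = 0 := by
  have hfactor : (fun g : Gal(Ks/K) => g a).FactorsThrough (fun g => α g x) := fun g h hgh => by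
    have hfix := ha ⟨h⁻¹ * g, apply_eq_apply_iff_inv_mul_mem_pointStabilizer.mp hgh⟩
    exact (AlgEquiv.symm_apply_eq h).mp hfix
  let y : X → Ks := Function.extend (fun g => α g x) (fun g => g a) 0
  have hy : ∀ g, y (α g x) = g a := hfactor.extend_apply 0
  have hy0 : ∀ x', (∀ g, α g x ≠ x') → y x' = 0 := fun x' hx' =>
    Function.extend_apply' _ _ _ fun ⟨g, hg⟩ => hx' g hg
  refine ⟨y, fun g x' => ?_, hy, hy0⟩
  by_cases hx' : ∃ h, α h x = x'
  · obtain ⟨h, rfl⟩ := hx'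
    rw [← Equiv.Perm.mul_apply, ← map_mul, hy, hy, AlgEquiv.mul_apply]
  · push Not at hx'
    rw [hy0 x' hx', map_zero, hy0]
    intro h hh
    refine hx' (g⁻¹ * h) ?_
    rw [map_mul, Equiv.Perm.mul_apply, hh, map_inv, Equiv.Perm.inv_eq_iff_eq]

/-- Dedekind's independence of characters, applied to the embeddings of the field fixed by the
stabilizer of a point: these are in bijection with the orbit of the point. -/
theorem eq_zero_of_forall_equivariantFunctions_sum_eq_zero [IsGalois K Ks] [Fintype X]
    (hα : ∀ x, IsOpen (pointStabilizer α x : Set Gal(Ks/K))) {c : X → Ks}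
    (hc : ∀ y ∈ equivariantFunctions α, ∑ x, c x * y x = 0) : c = 0 := by
  classical
  funext x
  let F := IntermediateField.fixedField (pointStabilizer α x)
  have hF : F.fixingSubgroup = pointStabilizer α x :=
    InfiniteGalois.fixingSubgroup_fixedField
      ⟨pointStabilizer α x, Subgroup.isClosed_of_isOpen _ (hα x)⟩
  let orbit : Set X := Set.range fun g => α g x
  choose γ hγ using fun z : orbit => z.2
  let embedding (z : orbit) : F →* Ks := (γ z : Ks →* Ks).comp (F.val : F →* Ks)
  have hinj : Function.Injective embedding := fun z z' h => by
    have hmem : (γ z')⁻¹ * γ z ∈ F.fixingSubgroup := fun a =>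
      (AlgEquiv.symm_apply_eq (γ z')).mpr (DFunLike.congr_fun h a)
    rw [hF, ← apply_eq_apply_iff_inv_mul_mem_pointStabilizer] at hmem
    exact Subtype.ext ((hγ z).symm.trans (hmem.trans (hγ z')))
  have hli := (linearIndependent_monoidHom F Ks).comp embedding hinj
  refine Fintype.linearIndependent_iff.mp hli (fun z => c z) (funext fun a => ?_) ⟨x, 1, by simp⟩
  obtain ⟨y, hy, hya, hy0⟩ := exists_mem_equivariantFunctions_apply_eq (α := α) a.2
  rw [Finset.sum_apply, Pi.zero_apply, ← hc y hy]
  refine Fintype.sum_of_injective _ Subtype.val_injective _ _ (fun x' hx' => ?_) fun z => ?_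
  · rw [hy0 x' fun g hg => hx' ⟨⟨x', g, hg⟩, rfl⟩, mul_zero]
  · rw [← hγ z, hya, hγ z]
    rfl

theorem span_equivariantFunctions_eq_top [IsGalois K Ks] [Finite X]
    (hα : ∀ x, IsOpen (pointStabilizer α x : Set Gal(Ks/K))) :
    Submodule.span Ks (equivariantFunctions α : Set (X → Ks)) = ⊤ := by
  classical
  have := Fintype.ofFinite X
  by_contra h
  obtain ⟨f, hf, hspan⟩ := Submodule.exists_dual_map_eq_bot_of_lt_top (lt_top_iff_ne_top.mpr h)
    inferInstance
  have hzero : (fun x => f (Pi.single x 1)) = 0 :=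
    eq_zero_of_forall_equivariantFunctions_sum_eq_zero hα fun y hy => by
      have hfy : f y = 0 := by
        rw [← Submodule.mem_bot Ks, ← hspan]
        exact Submodule.mem_map_of_mem (Submodule.subset_span hy)
      rw [← hfy, LinearMap.pi_apply_eq_sum_univ f y]
      refine Finset.sum_congr rfl fun x _ => ?_
      rw [mul_comm, smul_eq_mul]
      congr 2
      exact funext fun x' => (Pi.single_apply x (1 : Ks) x').trans (if_congr eq_comm rfl rfl)
  exact hf (LinearMap.pi_ext' fun x => LinearMap.ext_ring (congrFun hzero x))

theorem repr_mem_range_algebraMap_of_mem_equivariantFunctions [IsGalois K Ks] {I : Type*}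
    [Finite I] (B : Module.Basis I Ks (X → Ks)) (hB : ∀ i, B i ∈ equivariantFunctions α)
    {y : X → Ks} (hy : y ∈ equivariantFunctions α) (i : I) :
    B.repr y i ∈ Set.range (algebraMap K Ks) := by
  have := Fintype.ofFinite I
  rw [InfiniteGalois.mem_range_algebraMap_iff_fixed]
  intro g
  have hconj : ∑ j, g (B.repr y j) • B j = y := by
    funext x
    obtain ⟨x, rfl⟩ := (α g).surjective x
    rw [← mem_equivariantFunctions.mp hy]
    conv_rhs => rw [← B.sum_repr y]
    simp only [Finset.sum_apply, Pi.smul_apply, smul_eq_mul, map_sum, map_mul,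
      mem_equivariantFunctions.mp (hB _)]
  conv_rhs => rw [← hconj, B.repr_sum_self]

theorem span_range_eq_equivariantFunctions [IsGalois K Ks] {I : Type*} [Finite I]
    (B : Module.Basis I Ks (X → Ks)) (hB : ∀ i, B i ∈ equivariantFunctions α) :
    Submodule.span K (Set.range B) = Subalgebra.toSubmodule (equivariantFunctions α) := by
  have := Fintype.ofFinite I
  refine le_antisymm (Submodule.span_le.mpr ?_) fun y hy => ?_
  · rintro - ⟨i, rfl⟩
    exact hB i
  · rw [← B.sum_repr y]
    refine Submodule.sum_mem _ fun i _ => ?_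
    obtain ⟨a, ha⟩ := repr_mem_range_algebraMap_of_mem_equivariantFunctions B hB hy i
    rw [← ha, algebraMap_smul]
    exact Submodule.smul_mem _ _ (Submodule.subset_span ⟨i, rfl⟩)

theorem exists_basis_mem_equivariantFunctions [IsGalois K Ks] [Finite X]
    (hα : ∀ x, IsOpen (pointStabilizer α x : Set Gal(Ks/K))) :
    ∃ B : Module.Basis X Ks (X → Ks), ∀ i, B i ∈ equivariantFunctions α := by
  have := Fintype.ofFinite X
  obtain ⟨b, hb, hspan, hli⟩ := exists_linearIndependent Ks (equivariantFunctions α : Set (X → Ks))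
  rw [span_equivariantFunctions_eq_top hα] at hspan
  let B : Module.Basis b Ks (X → Ks) := .mk hli (by rw [Subtype.range_coe, hspan])
  have := Module.Finite.finite_basis B
  have := Fintype.ofFinite b
  let e : b ≃ X := Fintype.equivOfCardEq <| by
    rw [← Module.finrank_eq_card_basis B, Module.finrank_fintype_fun_eq_card]
  refine ⟨B.reindex e, fun i => ?_⟩
  rw [Module.Basis.reindex_apply, Module.Basis.mk_apply]
  exact hb (e.symm i).2

theorem isBaseChange_equivariantFunctions [IsGalois K Ks] [Finite X]
    (hα : ∀ x, IsOpen (pointStabilizer α x : Set Gal(Ks/K))) :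
    IsBaseChange Ks (equivariantFunctions α).val.toLinearMap := by
  obtain ⟨B, hB⟩ := exists_basis_mem_equivariantFunctions hα
  let b₀ := B.restrictScalars K
  let b : Module.Basis X K (equivariantFunctions α) :=
    b₀.map (LinearEquiv.ofEq _ _ (span_range_eq_equivariantFunctions B hB))
  have hb (i : X) : (b i : X → Ks) = B i := B.restrictScalars_apply K i
  exact isBaseChange_of_basis b B hb

theorem etale_equivariantFunctions [IsGalois K Ks] [Finite X]
    (hα : ∀ x, IsOpen (pointStabilizer α x : Set Gal(Ks/K))) :
    Algebra.Etale K (equivariantFunctions α) :=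
  etale_of_isBaseChange (isBaseChange_equivariantFunctions hα)

theorem finrank_equivariantFunctions [IsGalois K Ks] [Finite X]
    (hα : ∀ x, IsOpen (pointStabilizer α x : Set Gal(Ks/K))) :
    Module.finrank K (equivariantFunctions α) = Nat.card X := by
  have := Fintype.ofFinite X
  rw [← finrank_eq_of_isBaseChange (f := (equivariantFunctions α).val)
    (isBaseChange_equivariantFunctions hα), Module.finrank_fintype_fun_eq_card,
    Nat.card_eq_fintype_card]

/-- Evaluation of equivariant functions at a point, as a coordinate of their algebra. -/
def evalCoord (α : Gal(Ks/K) →* Equiv.Perm X) (x : X) : Coord K Ks (equivariantFunctions α) :=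
  (Pi.evalAlgHom K (fun _ => Ks) x).comp (equivariantFunctions α).val

theorem evalCoord_injective [IsGalois K Ks] [Finite X]
    (hα : ∀ x, IsOpen (pointStabilizer α x : Set Gal(Ks/K))) :
    Function.Injective (evalCoord α) := by
  classical
  have := Fintype.ofFinite X
  intro x x' h
  by_contra hne
  have hzero := eq_zero_of_forall_equivariantFunctions_sum_eq_zero hα
    (c := Pi.single x 1 - Pi.single x' 1) fun y hy => by
      have hy' : y x = y x' := DFunLike.congr_fun h ⟨y, hy⟩
      simp [sub_mul, Finset.sum_sub_distrib, Pi.single_apply, hy']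
  simpa [Pi.single_apply, hne] using congrFun hzero x

theorem evalCoord_bijective [IsGalois K Ks] [Finite X]
    (hα : ∀ x, IsOpen (pointStabilizer α x : Set Gal(Ks/K))) :
    Function.Bijective (evalCoord α) := by
  have := etale_equivariantFunctions hα
  have := Algebra.FormallyUnramified.finite_of_free K (equivariantFunctions α)
  refine (evalCoord_injective hα).bijective_of_nat_card_le ?_
  rw [← finrank_equivariantFunctions hα]
  exact card_algHom_le_finrank K _ Ks

end GaloisSets

section Coordinates

theorem leftMulMatrix_piBasisFun {R I : Type*} [CommRing R] [Fintype I] [DecidableEq I]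
    (v : I → R) :
    Algebra.leftMulMatrix (Pi.basisFun R I) v = Matrix.diagonal v := by
  ext i j
  simp [Algebra.leftMulMatrix_eq_repr_mul, Pi.single_apply, Matrix.diagonal_apply]

theorem norm_pi {R I : Type*} [CommRing R] [Fintype I] (v : I → R) :
    Algebra.norm R v = ∏ i, v i := by
  classical
  rw [Algebra.norm_eq_matrix_det (Pi.basisFun R I), leftMulMatrix_piBasisFun, Matrix.det_diagonal]

theorem trace_pi {R I : Type*} [CommRing R] [Fintype I] (v : I → R) :
    Algebra.trace R (I → R) v = ∑ i, v i := by
  classical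
  rw [Algebra.trace_eq_matrix_trace (Pi.basisFun R I), leftMulMatrix_piBasisFun,
    Matrix.trace_diagonal]

variable (K Ks T : Type*) [Field K] [Field Ks] [Algebra K Ks] [CommRing T] [Algebra K T]

/-- The Galois action on the coordinates of `T`, as a permutation representation. -/
def coordPerm : Gal(Ks/K) →* Equiv.Perm (Coord K Ks T) where
  toFun g := ⟨galCoord g, galCoord g⁻¹, fun ι => AlgHom.ext fun x => g.symm_apply_apply (ι x),
    fun ι => AlgHom.ext fun x => g.apply_symm_apply (ι x)⟩
  map_one' := rfl
  map_mul' _ _ := rfl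

theorem coordPerm_apply_apply (g : Gal(Ks/K)) (ι : Coord K Ks T) (x : T) :
    coordPerm K Ks T g ι x = g (ι x) := rfl

theorem isOpen_pointStabilizer_coordPerm [Algebra.IsIntegral K Ks] [Module.Finite K T]
    (ι : Coord K Ks T) : IsOpen (pointStabilizer (coordPerm K Ks T) ι : Set Gal(Ks/K)) := by
  let b := Module.finBasis K T
  have h : (pointStabilizer (coordPerm K Ks T) ι : Set Gal(Ks/K))
      = ⋂ j, (MulAction.stabilizer Gal(Ks/K) (ι (b j)) : Set _) := by
    ext g
    simp only [Set.mem_iInter, SetLike.mem_coe, MulAction.mem_stabilizer_iff, mem_pointStabilizer]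
    refine ⟨fun hg j => DFunLike.congr_fun hg (b j), fun hg => AlgHom.toLinearMap_injective ?_⟩
    exact b.ext hg
  rw [h]
  exact isOpen_iInter_of_finite fun j => stabilizer_isOpen_of_isIntegral _

open scoped TensorProduct in
theorem isBaseChange_minkowski [IsSepClosed Ks] [Algebra.Etale K T] :
    IsBaseChange Ks (minkowski K Ks T).toLinearMap := by
  have := Algebra.FormallyUnramified.finite_of_free K T
  obtain ⟨n, ⟨e⟩⟩ := Algebra.IsFiniteSplit.nonempty_algEquiv_fun Ks (Ks ⊗[K] T)
  have hn : Module.finrank K T = n := by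
    rw [← Module.finrank_baseChange (R := Ks), e.toLinearEquiv.finrank_eq, Module.finrank_fin_fun]
  let φ (i : Fin n) : Ks ⊗[K] T →ₐ[Ks] Ks := (Pi.evalAlgHom Ks (fun _ => Ks) i).comp e
  let p (i : Fin n) : Coord K Ks T :=
    ((φ i).restrictScalars K).comp Algebra.TensorProduct.includeRight
  have hp : Function.Injective p := fun i j hij => by
    have h : φ i = φ j := Algebra.TensorProduct.ext (Subsingleton.elim _ _) hij
    by_contra hne
    simpa [φ, hne] using DFunLike.congr_fun h (e.symm (Pi.single i 1))
  have hcard : Nat.card (Coord K Ks T) ≤ Nat.card (Fin n) := by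
    rw [Nat.card_fin, ← hn]
    exact card_algHom_le_finrank K T Ks
  let q : Fin n ≃ Coord K Ks T := .ofBijective p (hp.bijective_of_nat_card_le hcard)
  have hlift (i : Fin n) : (Pi.evalAlgHom Ks (fun _ => Ks) (p i)).comp
      (Algebra.TensorProduct.lift (Algebra.ofId Ks _) (minkowski K Ks T) fun _ _ => .all _ _)
      = φ i := by
    refine Algebra.TensorProduct.ext (Subsingleton.elim _ _) (AlgHom.ext fun x => ?_)
    simp [minkowski, p]
  refine isBaseChange_of_bijective_lift ?_
  rw [← Function.Bijective.of_comp_iff' (q.symm.arrowCongr (.refl Ks)).bijective]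
  convert e.bijective using 1
  exact funext fun z => funext fun i => DFunLike.congr_fun (hlift i) z

variable {K Ks T}

theorem norm_minkowski [IsSepClosed Ks] [Algebra.Etale K T] (x : T) :
    Algebra.norm Ks (minkowski K Ks T x) = algebraMap K Ks (Algebra.norm K x) :=
  have := Algebra.FormallyUnramified.finite_of_free K T
  norm_apply_of_isBaseChange (isBaseChange_minkowski K Ks T) x

theorem minkowski_injective [IsSepClosed Ks] [Algebra.Etale K T] :
    Function.Injective (minkowski K Ks T) :=
  injective_of_isBaseChange (isBaseChange_minkowski K Ks T)

theorem range_minkowski [IsSepClosure K Ks] [Algebra.Etale K T] :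
    (minkowski K Ks T).range = equivariantFunctions (coordPerm K Ks T) := by
  have := Algebra.FormallyUnramified.finite_of_free K T
  have : IsSepClosed Ks := IsSepClosure.sep_closed K
  let b := Module.finBasis K T
  let B := (isBaseChange_minkowski K Ks T).basis b
  have hB : ⇑B = (minkowski K Ks T).toLinearMap ∘ b :=
    funext <| (isBaseChange_minkowski K Ks T).basis_apply b
  refine Subalgebra.toSubmodule_injective ?_
  rw [← span_range_eq_equivariantFunctions B fun i => hB ▸ fun g ι => rfl, hB, Set.range_comp,
    ← Submodule.map_span, b.span_eq, Submodule.map_top]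
  rfl

end Coordinates

section Characters

variable {M F C : Type*} [AddCommGroup M] [Field F]

theorem addOrderOf_eq_exponent_iff_ne_zero (hM : (Nat.card M).Prime) {x : M} :
    addOrderOf x = AddMonoid.exponent M ↔ x ≠ 0 := by
  have := Fact.mk hM
  have := isAddCyclic_of_prime_card (α := M) rfl
  rw [IsAddCyclic.exponent_eq_card]
  refine ⟨?_, addOrderOf_eq_prime (card_nsmul_eq_zero' (x := x))⟩
  rintro h rfl
  exact hM.one_lt.ne (addOrderOf_zero.symm.trans h)

theorem addChar_injective_of_ne_zero (hM : (Nat.card M).Prime) {ψ : AddChar M F}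
    (hψ : ψ ≠ 0) : Function.Injective ψ := by
  have := Fact.mk hM
  refine ψ.toAddMonoidHom.ker_eq_bot_iff.mp ?_
  refine ψ.toAddMonoidHom.ker.eq_bot_or_eq_top_of_prime_card.resolve_right fun h => hψ ?_
  exact AddChar.toAddMonoidHomEquiv.injective (AddMonoidHom.ker_eq_top_iff.mp h)

/-- No nontrivial character of a group of odd order is its own inverse. -/
theorem prod_addChar_apply_eq_one_of_odd_card [Fintype (AddChar M F)] (hM : Odd (Nat.card M))
    (x : M) : ∏ ψ : AddChar M F, ψ x = 1 := by
  have hself {ψ : AddChar M F} (h : -ψ = ψ) : ψ = 0 := by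
    have h2 : 2 • ψ = 0 := by rw [two_nsmul]; nth_rw 1 [← h]; exact neg_add_cancel ψ
    have hcard : Nat.card M • ψ = 0 := by
      ext x
      rw [AddChar.nsmul_apply, ← AddChar.map_nsmul_eq_pow, card_nsmul_eq_zero']
      simp
    refine AddMonoid.addOrderOf_eq_one_iff.mp (Nat.eq_one_of_dvd_coprimes
      hM.coprime_two_left (addOrderOf_dvd_of_nsmul_eq_zero h2)
      (addOrderOf_dvd_of_nsmul_eq_zero hcard))
  refine Finset.prod_involution (fun ψ _ => -ψ) (fun ψ _ => ?_) (fun ψ _ hψ h => hψ ?_)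
    (fun _ _ => Finset.mem_univ _) fun ψ _ => neg_neg ψ
  · rw [← AddChar.add_apply, add_neg_cancel, AddChar.zero_apply]
  · rw [hself h, AddChar.zero_apply]

theorem addChar_apply_pow_card_eq_one (ψ : AddChar M F) (x : M) : ψ x ^ Nat.card M = 1 := by
  rw [← AddChar.map_nsmul_eq_pow, card_nsmul_eq_zero', AddChar.map_zero_eq_one]

theorem exists_addChar_apply_eq_of_pow_card_eq_one (hM : (Nat.card M).Prime) {ψ : AddChar M F}
    (hψ : ψ ≠ 0) {ζ : F} (hζ : ζ ^ Nat.card M = 1) : ∃ x, ψ x = ζ := by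
  have := NeZero.mk hM.ne_zero
  let f (x : M) : rootsOfUnity (Nat.card M) F :=
    rootsOfUnity.mkOfPowEq (ψ x) (addChar_apply_pow_card_eq_one ψ x)
  have hf : Function.Injective f := fun x x' h =>
    addChar_injective_of_ne_zero hM hψ congr((($h : Fˣ) : F))
  obtain ⟨x, hx⟩ := (hf.bijective_of_nat_card_le (card_rootsOfUnity F _)).surjective
    (rootsOfUnity.mkOfPowEq ζ hζ)
  exact ⟨x, congr((($hx : Fˣ) : F))⟩

section Duality

variable [Finite M] [HasEnoughRootsOfUnity F (AddMonoid.exponent M)]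

theorem card_addChar_of_hasEnoughRootsOfUnity : Nat.card (AddChar M F) = Nat.card M := by
  have : HasEnoughRootsOfUnity F (Monoid.exponent (Multiplicative M)) := by
    rwa [Monoid.exponent_multiplicative]
  let f (φ : Multiplicative M →* Fˣ) : AddChar M F :=
    AddChar.toMonoidHomEquiv.symm ((Units.coeHom F).comp φ)
  have hf : Function.Bijective f :=
    ⟨fun φ φ' h => MonoidHom.ext fun x => Units.ext (DFunLike.congr_fun h x.toAdd),
      fun ψ => ⟨ψ.toMonoidHom.toHomUnits, rfl⟩⟩
  rw [← Nat.card_eq_of_bijective f hf, CommGroup.card_monoidHom_of_hasEnoughRootsOfUnity]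
  rfl

variable (F) in
theorem exists_addChar_apply_ne_one {x : M} (hx : x ≠ 0) : ∃ ψ : AddChar M F, ψ x ≠ 1 := by
  have : HasEnoughRootsOfUnity F (Monoid.exponent (Multiplicative M)) := by
    rwa [Monoid.exponent_multiplicative]
  obtain ⟨φ, hφ⟩ := CommGroup.exists_apply_ne_one_of_hasEnoughRootsOfUnity (Multiplicative M) F
    (a := .ofAdd x) hx
  exact ⟨AddChar.toMonoidHomEquiv.symm ((Units.coeHom F).comp φ), fun h => hφ (Units.ext h)⟩

theorem sum_addChar_apply_eq_ite [Fintype (AddChar M F)] [DecidableEq M] (x : M) :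
    ∑ ψ : AddChar M F, ψ x = if x = 0 then (Nat.card M : F) else 0 := by
  classical
  have h : (AddChar.doubleDualEmb x : AddChar (AddChar M F) F) = 0 ↔ x = 0 := by
    refine ⟨fun h => ?_, fun h => by rw [h, map_zero]⟩
    by_contra hx
    obtain ⟨ψ, hψ⟩ := exists_addChar_apply_ne_one F hx
    exact hψ (DFunLike.congr_fun h ψ)
  simpa only [h, AddChar.doubleDualEmb_apply, ← Nat.card_eq_fintype_card,
    card_addChar_of_hasEnoughRootsOfUnity] using (AddChar.doubleDualEmb x).sum_eq_ite (R := F)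

end Duality

section Fourier

variable [Fintype M]

/-- The Fourier coefficient of the function `y` at the character `ψ`, without normalising factor. -/
def fourierCoeff (ψ : AddChar M F) (y : M → F) : F := ∑ x, ψ (-x) * y x

theorem sum_apply_mul_fourierCoeff [Fintype (AddChar M F)]
    [HasEnoughRootsOfUnity F (AddMonoid.exponent M)] (y : M → F) (z : M) :
    ∑ ψ : AddChar M F, ψ z * fourierCoeff ψ y = Nat.card M * y z := by
  classical
  have horth (x : M) : ∑ ψ : AddChar M F, ψ z * (ψ (-x) * y x)
      = if x = z then Nat.card M * y z else 0 := by
    simp only [← mul_assoc, ← AddChar.map_add_eq_mul, ← Finset.sum_mul, ← sub_eq_add_neg]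
    rw [sum_addChar_apply_eq_ite, ite_mul, zero_mul]
    refine ite_congr (propext (sub_eq_zero.trans eq_comm)) (fun h => ?_) fun _ => rfl
    rw [h]
  simp only [fourierCoeff, Finset.mul_sum]
  rw [Finset.sum_comm, Fintype.sum_congr _ _ horth, Fintype.sum_ite_eq']

end Fourier

section NontrivialCharacters

variable (χ : C ≃ {ψ : AddChar M F // ψ ≠ 0})

/-- An enumeration of the nontrivial characters, extended to all characters by `none ↦ 0`. -/
noncomputable def optionEquivAddChar : Option C ≃ AddChar M F := by
  classical exact χ.optionCongr.trans (.optionSubtypeNe 0)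

@[to_additive]
theorem prod_addChar_eq_mul_prod_nontrivial {A : Type*} [CommMonoid A] [Fintype C]
    [Fintype (AddChar M F)] (f : AddChar M F → A) : ∏ ψ, f ψ = f 0 * ∏ ι, f (χ ι).1 := by
  rw [← (optionEquivAddChar χ).prod_comp, Fintype.prod_option]
  rfl

theorem prod_nontrivial_apply_eq_one [Fintype C] (hM : Odd (Nat.card M)) (x : M) :
    ∏ ι, (χ ι).1 x = 1 := by
  have := Fintype.ofEquiv _ (optionEquivAddChar χ)
  rw [← prod_addChar_apply_eq_one_of_odd_card (F := F) hM x,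
    prod_addChar_eq_mul_prod_nontrivial χ, AddChar.zero_apply, one_mul]

theorem fourier_inversion [Fintype M] [HasEnoughRootsOfUnity F (AddMonoid.exponent M)]
    [Fintype C] (y : M → F) (z : M) :
    ∑ x, y x + ∑ ι, (χ ι).1 z * fourierCoeff (χ ι).1 y = Nat.card M * y z := by
  have := Fintype.ofEquiv _ (optionEquivAddChar χ)
  rw [← sum_apply_mul_fourierCoeff, sum_addChar_eq_add_sum_nontrivial χ]
  simp only [fourierCoeff, AddChar.zero_apply, one_mul]

variable [HasEnoughRootsOfUnity F (AddMonoid.exponent M)] (hM : Nat.card M = 3)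

include χ hM

theorem card_eq_two_of_nontrivial_equiv : Nat.card C = 2 := by
  have : Finite M := Nat.finite_of_card_ne_zero (by lia)
  have h : Nat.card (Option C) = 3 := by
    rw [Nat.card_congr (optionEquivAddChar χ), card_addChar_of_hasEnoughRootsOfUnity, hM]
  have : Finite (Option C) := Nat.finite_of_card_ne_zero (by lia)
  have : Finite C := .of_injective _ (Option.some_injective C)
  rw [Finite.card_option] at h
  lia

theorem nonempty_of_nontrivial_equiv : Nonempty C :=
  (Nat.card_pos_iff.mp (by rw [card_eq_two_of_nontrivial_equiv χ hM]; exact two_pos)).1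

variable [Fintype C]

theorem exists_forall_nontrivial_apply_eq {ω : C → F} (hω : ω ^ 3 = 1) (hprod : ∏ ι, ω ι = 1) :
    ∃ x, ∀ ι, (χ ι).1 x = ω ι := by
  classical
  obtain ⟨i, j, hij, huniv⟩ := Finset.card_eq_two.mp
    (Nat.card_eq_fintype_card.symm.trans (card_eq_two_of_nontrivial_equiv χ hM))
  obtain ⟨x, hi⟩ := exists_addChar_apply_eq_of_pow_card_eq_one (hM ▸ Nat.prime_three) (χ i).2
    (hM ▸ congrFun hω i)
  have hj : (χ j).1 x = ω j := by
    have h := hprod.trans (prod_nontrivial_apply_eq_one χ (by rw [hM]; decide) x).symm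
    rw [huniv, Finset.prod_pair hij, Finset.prod_pair hij, hi] at h
    exact (mul_left_cancel₀ (Finset.prod_ne_zero_iff.mp (hprod ▸ one_ne_zero) i
      (Finset.mem_univ i)) h).symm
  refine ⟨x, fun ι => ?_⟩
  have hι : ι ∈ ({i, j} : Finset C) := huniv ▸ Finset.mem_univ ι
  rw [Finset.mem_insert, Finset.mem_singleton] at hι
  rcases hι with rfl | rfl <;> assumption

theorem exists_forall_nontrivial_mul_eq {θ θ' : C → F}
    (h3 : θ' ^ 3 = θ ^ 3) (hθ : ∏ ι, θ ι = 1) (hθ' : ∏ ι, θ' ι = 1) :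
    ∃ u, ∀ ι, θ' ι = (χ ι).1 u * θ ι := by
  have hne (ι : C) : θ ι ≠ 0 := Finset.prod_ne_zero_iff.mp (hθ ▸ one_ne_zero) ι (Finset.mem_univ ι)
  obtain ⟨u, hu⟩ := exists_forall_nontrivial_apply_eq χ hM (ω := θ' / θ)
    (funext fun ι => by
      rw [div_pow, h3]
      exact div_self (pow_ne_zero 3 (hne ι)))
    (by simp only [Pi.div_apply, Finset.prod_div_distrib, hθ, hθ', div_one])
  exact ⟨u, fun ι => by rw [hu, Pi.div_apply, div_mul_cancel₀ _ (hne ι)]⟩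

/-- Evaluation at the nontrivial characters identifies a group of order three with the cube
roots of unity of norm one. -/
noncomputable def omegaEquiv : M ≃ Omega F C :=
  have hpow (x : M) : (fun ι => (χ ι).1 x) ^ 3 = 1 := funext fun ι => by
    rw [Pi.pow_apply, ← hM, addChar_apply_pow_card_eq_one, Pi.one_apply]
  have hnorm (x : M) : Algebra.norm F (fun ι => (χ ι).1 x) = 1 := by
    rw [norm_pi, prod_nontrivial_apply_eq_one χ (by rw [hM]; decide)]
  .ofBijective (fun x => ⟨fun ι => (χ ι).1 x, hpow x, hnorm x⟩) <| by
    refine ⟨fun x x' h => ?_, fun ω => ?_⟩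
    · obtain ⟨ι⟩ := nonempty_of_nontrivial_equiv χ hM
      exact addChar_injective_of_ne_zero (hM ▸ Nat.prime_three) (χ ι).2
        (congrFun (congrArg Subtype.val h) ι)
    · obtain ⟨x, hx⟩ := exists_forall_nontrivial_apply_eq χ hM ω.2.1 ((norm_pi _).symm.trans ω.2.2)
      exact ⟨x, Subtype.ext (funext hx)⟩

@[simp]
theorem omegaEquiv_apply (x : M) (ι : C) : (omegaEquiv χ hM x).1 ι = (χ ι).1 x := rfl

end NontrivialCharacters

instance [IsSepClosed F] [NeZero (Nat.card M : F)] :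
    HasEnoughRootsOfUnity F (AddMonoid.exponent M) :=
  have : NeZero (Nat.card M) := .of_neZero_natCast F
  .of_dvd F AddGroup.exponent_dvd_nat_card

end Characters

section TateDual

variable {Ks M : Type*} [Field Ks] [AddCommGroup M]

theorem TateDual.eval_zero (f : TateDual Ks M) : f.eval 0 = 1 := by
  have h := AddMonoidHom.map_zero f
  exact congr(((($h).toMul : Ksˣ) : Ks))

theorem TateDual.eval_add (f : TateDual Ks M) (x y : M) : f.eval (x + y) = f.eval x * f.eval y := by
  have h := AddMonoidHom.map_add f x y
  exact congr(((($h).toMul : Ksˣ) : Ks))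

/-- An element of the Tate dual of `M`, as a character of `M` with values in `Ks`. -/
noncomputable def TateDual.toAddChar : TateDual Ks M →+ AddChar M Ks where
  toFun f := ⟨f.eval, f.eval_zero, f.eval_add⟩
  map_zero' := rfl
  map_add' _ _ := rfl

theorem TateDual.toAddChar_bijective [Finite M] :
    Function.Bijective (TateDual.toAddChar (Ks := Ks) (M := M)) := by
  refine ⟨fun f f' h => AddMonoidHom.ext fun x => Subtype.ext (Units.ext (DFunLike.congr_fun h x)),
    fun ψ => ?_⟩
  have hψ (x : M) : ψ x ^ AddMonoid.exponent M = 1 := by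
    rw [← AddChar.map_nsmul_eq_pow, AddMonoid.exponent_nsmul_eq_zero, AddChar.map_zero_eq_one]
  let f : M →+ Additive (rootsOfUnity (AddMonoid.exponent M) Ks) :=
    .mk' (fun x => .ofMul (rootsOfUnity.mkOfPowEq (ψ x) (hψ x)))
      fun x y => Subtype.ext (Units.ext (ψ.map_add_eq_mul x y))
  exact ⟨f, rfl⟩

/-- The elements of maximal order in the Tate dual of a group of prime order are its nontrivial
characters. -/
noncomputable def maxOrderEquivNontrivial [IsSepClosed Ks] [NeZero (Nat.card M : Ks)]
    (hM : (Nat.card M).Prime) : MaxOrder (TateDual Ks M) ≃ {ψ : AddChar M Ks // ψ ≠ 0} :=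
  have : Finite M := Nat.finite_of_card_ne_zero hM.ne_zero
  have hcard : Nat.card (TateDual Ks M) = Nat.card M := by
    rw [Nat.card_eq_of_bijective _ TateDual.toAddChar_bijective,
      card_addChar_of_hasEnoughRootsOfUnity]
  (Equiv.ofBijective _ TateDual.toAddChar_bijective).subtypeEquiv fun f =>
    (addOrderOf_eq_exponent_iff_ne_zero (hcard ▸ hM)).trans
      (map_ne_zero_iff _ TateDual.toAddChar_bijective.injective).symm

end TateDual

section AffineAction

variable {G M : Type*} [Group G] [TopologicalSpace G] [AddCommGroup M] [TopologicalSpace M]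
  [IsTopologicalAddGroup M] [DistribMulAction G M]

theorem Z1.map_mul (c : Z1 G M) (g h : G) : c.1 (g * h) = c.1 g + g • c.1 h := c.2.2 g h

/-- The affine action of `G` on `M` attached to the cocycle `c`. -/
def affinePerm (c : Z1 G M) : G →* Equiv.Perm M :=
  MonoidHom.mk' (fun g => (MulAction.toPerm g).trans (Equiv.addRight (c.1 g))) fun g h =>
    Equiv.ext fun x => by
      simp only [Equiv.trans_apply, Equiv.Perm.mul_apply, MulAction.toPerm_apply,
        Equiv.coe_addRight, mul_smul, Z1.map_mul, smul_add]
      abel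

theorem affinePerm_apply (c : Z1 G M) (g : G) (x : M) : affinePerm c g x = g • x + c.1 g := rfl

theorem mem_B1 {c : Z1 G M} : c ∈ B1 G M ↔ ∃ u : M, ∀ g, c.1 g = g • u - u := Iff.rfl

end AffineAction

section KummerCocycles

variable {K Ks C M : Type*} [Field K] [Field Ks] [Algebra K Ks] [AddCommGroup M]
  {α : Gal(Ks/K) →* Equiv.Perm C} {χ : C → AddChar M Ks} {θ θ' : C → Ks} {c c' : Gal(Ks/K) → M}

/-- The function `c` describes the Galois action on `θ`: the conjugate of `θ` by `g` is the
product of `θ` and of the image of `c g` under the characters `χ`. -/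
def IsKummerCocycle (α : Gal(Ks/K) →* Equiv.Perm C) (χ : C → AddChar M Ks) (θ : C → Ks)
    (c : Gal(Ks/K) → M) : Prop :=
  ∀ g ι, g (θ ι) = χ (α g ι) (c g) * θ (α g ι)

theorem isKummerCocycle_zero_iff : IsKummerCocycle α χ θ 0 ↔ θ ∈ equivariantFunctions α := by
  simp only [IsKummerCocycle, Pi.zero_apply, AddChar.map_zero_eq_one, one_mul,
    mem_equivariantFunctions]

namespace IsKummerCocycle

theorem mul (h : IsKummerCocycle α χ θ c) (h' : IsKummerCocycle α χ θ' c') :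
    IsKummerCocycle α χ (θ * θ') (c + c') := fun g ι => by
  rw [Pi.mul_apply, map_mul, h, h', Pi.add_apply, AddChar.map_add_eq_mul, Pi.mul_apply,
    mul_mul_mul_comm]

theorem inv (h : IsKummerCocycle α χ θ c) : IsKummerCocycle α χ θ⁻¹ (-c) := fun g ι => by
  rw [Pi.inv_apply, map_inv₀, h, mul_inv, Pi.neg_apply, AddChar.map_neg_eq_inv, Pi.inv_apply]

theorem div_mem_equivariantFunctions (h : IsKummerCocycle α χ θ c)
    (h' : IsKummerCocycle α χ θ' c) : θ / θ' ∈ equivariantFunctions α := by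
  rw [← isKummerCocycle_zero_iff (χ := χ), ← add_neg_cancel c, div_eq_mul_inv]
  exact h.mul h'.inv

theorem pow_card_mem_equivariantFunctions (h : IsKummerCocycle α χ θ c) :
    θ ^ Nat.card M ∈ equivariantFunctions α := fun g ι => by
  rw [Pi.pow_apply, map_pow, h, mul_pow, addChar_apply_pow_card_eq_one, one_mul, Pi.pow_apply]

theorem unique [Nonempty C] (hinj : ∀ ι, Function.Injective (χ ι)) (hθ : ∀ ι, θ ι ≠ 0)
    (h : IsKummerCocycle α χ θ c) (h' : IsKummerCocycle α χ θ c') : c = c' := by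
  funext g
  obtain ⟨ι⟩ := ‹Nonempty C›
  exact hinj (α g ι) (mul_right_cancel₀ (hθ (α g ι)) ((h g ι).symm.trans (h' g ι)))

theorem continuous [Algebra.IsIntegral K Ks] [Nonempty C] [TopologicalSpace M]
    (hα : ∀ ι, IsOpen (pointStabilizer α ι : Set Gal(Ks/K)))
    (hinj : ∀ ι, Function.Injective (χ ι)) (hθ : ∀ ι, θ ι ≠ 0) (h : IsKummerCocycle α χ θ c) :
    Continuous c := by
  refine ((IsLocallyConstant.iff_eventually_eq c).mpr fun g => ?_).continuous
  obtain ⟨ι⟩ := ‹Nonempty C›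
  have hstab : ∀ᶠ s : Gal(Ks/K) in nhds 1, α s ι = ι ∧ s (θ ι) = θ ι :=
    .and ((hα ι).mem_nhds (one_mem _)) <|
      (stabilizer_isOpen_of_isIntegral (θ ι)).mem_nhds (one_mem _)
  have htranslate : Filter.Tendsto (fun s => g⁻¹ * s) (nhds g) (nhds 1) := by
    simpa using (continuous_const_mul g⁻¹).tendsto g
  filter_upwards [htranslate.eventually hstab] with s ⟨hsι, hsθ⟩
  rw [map_mul, Equiv.Perm.mul_apply, map_inv, Equiv.Perm.inv_eq_iff_eq] at hsι
  have hsθ : s (θ ι) = g (θ ι) := (AlgEquiv.symm_apply_eq g).mp hsθ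
  rw [h, h g, hsι] at hsθ
  exact hinj _ (mul_right_cancel₀ (hθ _) hsθ)

end IsKummerCocycle

variable [DistribMulAction Gal(Ks/K) M]

/-- Compatibility of the family of characters `χ`, indexed by a Galois set, with the Galois
actions. -/
def IsEquivariant (α : Gal(Ks/K) →* Equiv.Perm C) (χ : C → AddChar M Ks) : Prop :=
  ∀ g ι x, χ (α g ι) (g • x) = g (χ ι x)

theorem IsEquivariant.isKummerCocycle_coboundary (hχ : IsEquivariant α χ) (u : M) :
    IsKummerCocycle α χ (fun ι => χ ι u) fun g => g • u - u := fun g ι => by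
  rw [← hχ, ← AddChar.map_add_eq_mul, sub_add_cancel]

theorem IsKummerCocycle.map_mul [Nonempty C] (hinj : ∀ ι, Function.Injective (χ ι))
    (hχ : IsEquivariant α χ) (hθ : ∀ ι, θ ι ≠ 0) (h : IsKummerCocycle α χ θ c)
    (g g' : Gal(Ks/K)) : c (g * g') = c g + g • c g' := by
  obtain ⟨ι⟩ := ‹Nonempty C›
  apply hinj (α (g * g') ι)
  apply mul_right_cancel₀ (hθ (α (g * g') ι))
  rw [← h, AlgEquiv.mul_apply, h g', _root_.map_mul g, h g, ← hχ, _root_.map_mul α,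
    Equiv.Perm.mul_apply, AddChar.map_add_eq_mul]
  ring

variable [TopologicalSpace M] [DiscreteTopology M]

theorem isKummerCocycle_fourierCoeff [Fintype M] (hχ : IsEquivariant α χ) (c : Z1 Gal(Ks/K) M)
    {y : M → Ks} (hy : y ∈ equivariantFunctions (affinePerm c)) :
    IsKummerCocycle α χ (fun ι => fourierCoeff (χ ι) y) c := fun g ι => by
  simp only [fourierCoeff, map_sum, Finset.mul_sum]
  refine Fintype.sum_equiv (affinePerm c g) _ _ fun x => ?_
  rw [map_mul, hy, ← hχ, ← mul_assoc, ← AddChar.map_add_eq_mul, affinePerm_apply, neg_add_rev,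
    add_neg_cancel_left, smul_neg]

theorem isOpen_pointStabilizer_affinePerm [ContinuousSMul Gal(Ks/K) M] (c : Z1 Gal(Ks/K) M)
    (x : M) : IsOpen (pointStabilizer (affinePerm c) x : Set Gal(Ks/K)) :=
  ((continuous_id.smul continuous_const).add c.2.1).isOpen_preimage _ (isOpen_discrete {x})

/-- The Lagrange resolvent `∑ x, χ ι (-x) * y x` of a suitable equivariant function `y` does not
vanish, by Dedekind's independence of characters. -/
theorem exists_isKummerCocycle_apply_ne_zero [IsGalois K Ks] [ContinuousSMul Gal(Ks/K) M]
    [Finite M] (hχ : IsEquivariant α χ) (c : Z1 Gal(Ks/K) M) (ι : C) :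
    ∃ η : C → Ks, IsKummerCocycle α χ η c ∧ η ι ≠ 0 := by
  have := Fintype.ofFinite M
  by_contra! h
  have hzero := eq_zero_of_forall_equivariantFunctions_sum_eq_zero
    (isOpen_pointStabilizer_affinePerm c) (c := fun x => χ ι (-x)) fun y hy =>
      h _ (isKummerCocycle_fourierCoeff hχ c hy)
  exact one_ne_zero ((χ ι).map_zero_eq_one.symm.trans (by simpa using congrFun hzero 0))

/-- Hilbert's Theorem 90 for the twist by `c` of the units of the algebra of functions on `C`. -/
theorem exists_isKummerCocycle_forall_ne_zero [IsGalois K Ks] [ContinuousSMul Gal(Ks/K) M]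
    [Finite M] (hχ : IsEquivariant α χ) (c : Z1 Gal(Ks/K) M) :
    ∃ η : C → Ks, IsKummerCocycle α χ η c ∧ ∀ ι, η ι ≠ 0 := by
  let := MulAction.compHom C α
  choose η hη hne using exists_isKummerCocycle_apply_ne_zero hχ c
  let rep (ι : C) : C := (⟦ι⟧ : MulAction.orbitRel.Quotient Gal(Ks/K) C).out
  have hrep (g : Gal(Ks/K)) (ι : C) : rep (α g ι) = rep ι :=
    congrArg Quotient.out (Quotient.sound ⟨g, rfl⟩)
  refine ⟨fun ι => η (rep ι) ι, fun g ι => ?_, fun ι (h0 : η (rep ι) ι = 0) => ?_⟩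
  · dsimp only
    rw [hrep]
    exact hη _ g ι
  · obtain ⟨g, hg⟩ : ∃ g, α g ι = rep ι :=
      Quotient.mk_out (s := MulAction.orbitRel Gal(Ks/K) C) ι
    have h := hη (rep ι) g ι
    rw [h0, map_zero, hg] at h
    exact (mul_eq_zero.mp h.symm).elim ((χ _).val_isUnit _).ne_zero (hne _)

end KummerCocycles

section Goursat

variable {A A' B B' : Type*} [AddCommGroup A] [AddCommGroup A'] [AddCommGroup B] [AddCommGroup B']

theorem exists_addEquiv_apply_eq_iff_mem {f : A →+ A'} {g : B →+ B'}
    (hf : Function.Surjective f) (hg : Function.Surjective g) {R : AddSubgroup (A × B)}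
    (hfst : ∀ a, ∃ b, (a, b) ∈ R) (hsnd : ∀ b, ∃ a, (a, b) ∈ R)
    (hf0 : ∀ a, (a, 0) ∈ R ↔ f a = 0) (hg0 : ∀ b, (0, b) ∈ R ↔ g b = 0) :
    ∃ Φ : A' ≃+ B', ∀ a b, Φ (f a) = g b ↔ (a, b) ∈ R := by
  have hker {a : A} {b : B} (hab : (a, b) ∈ R) : f a = 0 ↔ g b = 0 := by
    rw [← hf0, ← hg0]
    exact ⟨fun h => by simpa using R.sub_mem hab h, fun h => by simpa using R.sub_mem hab h⟩
  obtain ⟨Φ, hΦ⟩ := ((f.prodMap g).comp R.subtype).exists_addEquiv_range_eq_graph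
    (fun a' => by
      obtain ⟨a, rfl⟩ := hf a'
      obtain ⟨b, hab⟩ := hfst a
      exact ⟨⟨_, hab⟩, rfl⟩)
    (fun b' => by
      obtain ⟨b, rfl⟩ := hg b'
      obtain ⟨a, hab⟩ := hsnd b
      exact ⟨⟨_, hab⟩, rfl⟩)
    fun p q => by
      rw [← sub_eq_zero, ← sub_eq_zero (a := Prod.snd _)]
      simpa using hker (p - q).2
  refine ⟨Φ, fun a b => ?_⟩
  have hgraph : Φ (f a) = g b ↔ (f a, g b) ∈ ((f.prodMap g).comp R.subtype).range := by
    rw [hΦ]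
    rfl
  rw [hgraph]
  refine ⟨?_, fun hab => ⟨⟨_, hab⟩, rfl⟩⟩
  rintro ⟨⟨⟨a', b'⟩, hab'⟩, h⟩
  have ha : (a - a', 0) ∈ R := (hf0 _).mpr <| by
    rw [map_sub, sub_eq_zero]
    exact (congrArg Prod.fst h).symm
  have hb : (0, b - b') ∈ R := (hg0 _).mpr <| by
    rw [map_sub, sub_eq_zero]
    exact (congrArg Prod.snd h).symm
  simpa using R.add_mem hab' (R.add_mem ha hb)

end Goursat

section NormOneRoots

theorem exists_pow_eq_and_prod_eq_one {F C : Type*} [Field F] [IsSepClosed F] [Fintype C]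
    [Nonempty C] (n : ℕ) [NeZero (n : F)] {v : C → F} (hv : ∏ ι, v ι = 1) :
    ∃ θ : C → F, θ ^ n = v ∧ ∏ ι, θ ι = 1 := by
  classical
  choose θ hθ using fun ι => IsSepClosed.exists_pow_nat_eq (v ι) n
  obtain ⟨i⟩ := ‹Nonempty C›
  have := NeZero.of_neZero_natCast F (n := n)
  have hpow : (∏ ι, θ ι) ^ n = 1 := by
    rw [← Finset.prod_pow, Finset.prod_congr rfl fun ι _ => hθ ι, hv]
  have hne : ∏ ι, θ ι ≠ 0 := (IsUnit.of_pow_eq_one hpow (NeZero.ne n)).ne_zero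
  refine ⟨Pi.mulSingle i (∏ ι, θ ι)⁻¹ * θ, ?_, ?_⟩
  · rw [mul_pow, ← Pi.mulSingle_pow, inv_pow, hpow, inv_one, Pi.mulSingle_one, one_mul]
    exact funext hθ
  · simp only [Pi.mul_apply, Finset.prod_mul_distrib]
    rw [Finset.prod_pi_mulSingle']
    simp [hne]

end NormOneRoots

section KummerTheory

variable {K Ks C M : Type*} [Field K] [Field Ks] [Algebra K Ks] [IsGalois K Ks]
  [AddCommGroup M] [TopologicalSpace M] [DiscreteTopology M] [DistribMulAction Gal(Ks/K) M]
  [Fintype C] [HasEnoughRootsOfUnity Ks (AddMonoid.exponent M)] {α : Gal(Ks/K) →* Equiv.Perm C}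
  (χ : C ≃ {ψ : AddChar M Ks // ψ ≠ 0}) (hM : Nat.card M = 3)
  (hχ : IsEquivariant α fun ι => (χ ι).1)

include hM hχ

theorem exists_isKummerCocycle_of_pow_three_mem
    (hα : ∀ ι, IsOpen (pointStabilizer α ι : Set Gal(Ks/K))) {θ : C → Ks}
    (h3 : θ ^ 3 ∈ equivariantFunctions α) (hθ : ∏ ι, θ ι = 1) :
    ∃ c : Z1 Gal(Ks/K) M, IsKummerCocycle α (fun ι => (χ ι).1) θ c := by
  have := nonempty_of_nontrivial_equiv χ hM
  have hne (ι : C) : θ ι ≠ 0 := Finset.prod_ne_zero_iff.mp (hθ ▸ one_ne_zero) ι (Finset.mem_univ ι)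
  have hinj (ι : C) := addChar_injective_of_ne_zero (hM ▸ Nat.prime_three) (χ ι).2
  have hexists (g : Gal(Ks/K)) : ∃ u, ∀ ι, g (θ ((α g).symm ι)) = (χ ι).1 u * θ ι := by
    refine exists_forall_nontrivial_mul_eq χ hM (funext fun ι => ?_) hθ ?_
    · have h := h3 g ((α g).symm ι)
      rwa [Equiv.apply_symm_apply, Pi.pow_apply, map_pow] at h
    · rw [← map_prod, Equiv.prod_comp (α g).symm θ, hθ, map_one]
  choose c hc using hexists
  have hKummer : IsKummerCocycle α (fun ι => (χ ι).1) θ c := fun g ι => by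
    rw [← hc, Equiv.symm_apply_apply]
  exact ⟨⟨c, hKummer.continuous hα hinj hne, hKummer.map_mul hinj hχ hne⟩, hKummer⟩

theorem exists_isKummerCocycle_prod_eq_one [ContinuousSMul Gal(Ks/K) M] (c : Z1 Gal(Ks/K) M) :
    ∃ θ : C → Ks, IsKummerCocycle α (fun ι => (χ ι).1) θ c ∧ ∏ ι, θ ι = 1 := by
  have : Finite M := Nat.finite_of_card_ne_zero (by lia)
  obtain ⟨η, hη, hne⟩ := exists_isKummerCocycle_forall_ne_zero hχ c
  have hn : (fun _ => ∏ ι, η ι) ∈ equivariantFunctions α := fun g _ => by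
    rw [map_prod, Finset.prod_congr rfl fun ι _ => hη g ι, Finset.prod_mul_distrib,
      Equiv.prod_comp (α g) fun ι => (χ ι).1 (c.1 g), Equiv.prod_comp (α g) η,
      prod_nontrivial_apply_eq_one χ (by rw [hM]; decide), one_mul]
  refine ⟨(fun _ => ∏ ι, η ι) * (η * η)⁻¹, ?_, ?_⟩
  · have h := (isKummerCocycle_zero_iff.mpr hn).mul (hη.mul hη).inv
    convert h using 1
    have h3 : 3 • c.1 = 0 := funext fun g => by
      rw [Pi.smul_apply, ← hM, card_nsmul_eq_zero', Pi.zero_apply]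
    rw [zero_add, eq_neg_iff_add_eq_zero, ← h3]
    abel
  · have hC := card_eq_two_of_nontrivial_equiv χ hM
    simp only [Pi.mul_apply, Pi.inv_apply, Finset.prod_mul_distrib, Finset.prod_inv_distrib,
      Finset.prod_const, Finset.card_univ, ← Nat.card_eq_fintype_card, hC]
    rw [sq, mul_inv_cancel₀]
    exact mul_ne_zero (Finset.prod_ne_zero_iff.mpr fun ι _ => hne ι)
      (Finset.prod_ne_zero_iff.mpr fun ι _ => hne ι)

end KummerTheory

section KummerRelation

variable {K Ks T M : Type*} [Field K] [Field Ks] [Algebra K Ks] [CommRing T] [Algebra K T]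
  [Fintype (Coord K Ks T)] [AddCommGroup M] [TopologicalSpace M] [DiscreteTopology M]
  [DistribMulAction Gal(Ks/K) M]

theorem prod_minkowski_eq_one [IsSepClosed Ks] [Algebra.Etale K T] (δ : NormOne K T) :
    ∏ ι, minkowski K Ks T δ.1 ι = 1 := by
  have hδ : Algebra.norm K (δ.1 : T) = 1 := congrArg Units.val δ.2
  rw [← norm_pi, norm_minkowski, hδ, map_one]

theorem exists_normOne_minkowski_eq [IsSepClosure K Ks] [Algebra.Etale K T]
    {v : Coord K Ks T → Ks} (hv : v ∈ equivariantFunctions (coordPerm K Ks T))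
    (hprod : ∏ ι, v ι = 1) : ∃ δ : NormOne K T, minkowski K Ks T δ.1 = v := by
  have : IsSepClosed Ks := IsSepClosure.sep_closed K
  have := Algebra.FormallyUnramified.finite_of_free K T
  rw [← range_minkowski] at hv
  obtain ⟨y, rfl⟩ := hv
  have hy : Algebra.norm K y = 1 := by
    apply (algebraMap K Ks).injective
    rw [map_one, ← norm_minkowski, norm_pi]
    exact hprod
  have hunit : IsUnit y := by
    rw [← Algebra.lmul_isUnit_iff (R := K), LinearMap.isUnit_iff_isUnit_det]
    exact hy ▸ isUnit_one
  exact ⟨⟨hunit.unit, Units.ext hy⟩, rfl⟩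

/-- The pairs `(c, δ)` such that `δ` has a cube root of norm one with Kummer cocycle `c`. -/
def kummerRelation (χ : Coord K Ks T → AddChar M Ks) :
    AddSubgroup (Z1 Gal(Ks/K) M × Additive (NormOne K T)) where
  carrier := {p | ∃ θ, θ ^ 3 = minkowski K Ks T (p.2.toMul.1 : T) ∧ ∏ ι, θ ι = 1 ∧
    IsKummerCocycle (coordPerm K Ks T) χ θ p.1}
  zero_mem' := ⟨1, by simp, by simp, isKummerCocycle_zero_iff.mpr (one_mem _)⟩
  add_mem' := by
    rintro p q ⟨θ, h3, hprod, hθ⟩ ⟨θ', h3', hprod', hθ'⟩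
    exact ⟨θ * θ', by simp [mul_pow, h3, h3'], by simp [Finset.prod_mul_distrib, hprod, hprod'],
      hθ.mul hθ'⟩
  neg_mem' := by
    rintro p ⟨θ, h3, hprod, hθ⟩
    refine ⟨θ⁻¹, ?_, by simp [hprod], hθ.inv⟩
    rw [inv_pow, h3]
    exact (map_units_inv (minkowski K Ks T) p.2.toMul.1).symm

theorem mem_kummerRelation {χ : Coord K Ks T → AddChar M Ks} {c : Z1 Gal(Ks/K) M}
    {δ : NormOne K T} : (c, .ofMul δ) ∈ kummerRelation χ ↔
      ∃ θ, θ ^ 3 = minkowski K Ks T δ.1 ∧ ∏ ι, θ ι = 1 ∧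
        IsKummerCocycle (coordPerm K Ks T) χ θ c :=
  Iff.rfl

theorem zero_mem_kummerRelation_iff [IsSepClosure K Ks] [Algebra.Etale K T]
    {χ : Coord K Ks T → AddChar M Ks} (δ : NormOne K T) : (0, .ofMul δ) ∈ kummerRelation χ ↔
      δ ∈ (powMonoidHom 3 : NormOne K T →* NormOne K T).range := by
  have : IsSepClosed Ks := IsSepClosure.sep_closed K
  rw [mem_kummerRelation]
  constructor
  · rintro ⟨θ, h3, hprod, hθ⟩
    obtain ⟨ε, rfl⟩ := exists_normOne_minkowski_eq (isKummerCocycle_zero_iff.mp hθ) hprod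
    rw [← map_pow] at h3
    exact ⟨ε, Subtype.ext (Units.ext (minkowski_injective h3))⟩
  · rintro ⟨ε, rfl⟩
    refine ⟨minkowski K Ks T ε.1, (map_pow _ _ _).symm, prod_minkowski_eq_one ε,
      isKummerCocycle_zero_iff.mpr ?_⟩
    rw [← range_minkowski]
    exact ⟨_, rfl⟩

variable [HasEnoughRootsOfUnity Ks (AddMonoid.exponent M)]
  (χ : Coord K Ks T ≃ {ψ : AddChar M Ks // ψ ≠ 0}) (hM : Nat.card M = 3)
  (hχ : IsEquivariant (coordPerm K Ks T) fun ι => (χ ι).1)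

include hM hχ

theorem mem_kummerRelation_zero_iff (c : Z1 Gal(Ks/K) M) :
    (c, 0) ∈ kummerRelation (T := T) (fun ι => (χ ι).1) ↔ c ∈ B1 Gal(Ks/K) M := by
  have := nonempty_of_nontrivial_equiv χ hM
  have hinj (ι : Coord K Ks T) := addChar_injective_of_ne_zero (hM ▸ Nat.prime_three) (χ ι).2
  rw [← ofMul_one, mem_kummerRelation, mem_B1]
  constructor
  · rintro ⟨θ, h3, hprod, hθ⟩
    obtain ⟨u, hu⟩ := exists_forall_nontrivial_apply_eq χ hM (h3.trans (map_one _)) hprod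
    obtain rfl : (fun ι => (χ ι).1 u) = θ := funext hu
    exact ⟨u, congrFun <| hθ.unique hinj (fun ι => ((χ ι).1.val_isUnit u).ne_zero)
      (hχ.isKummerCocycle_coboundary u)⟩
  · rintro ⟨u, hu⟩
    refine ⟨fun ι => (χ ι).1 u, ?_, prod_nontrivial_apply_eq_one χ (by rw [hM]; decide) u,
      funext hu ▸ hχ.isKummerCocycle_coboundary u⟩
    rw [OneMemClass.coe_one, Units.val_one, map_one]
    exact funext fun ι => hM ▸ addChar_apply_pow_card_eq_one (χ ι).1 u

theorem mem_kummerRelation_iff_sub_mem_B1 {c σ : Z1 Gal(Ks/K) M} {δ : Additive (NormOne K T)}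
    (hc : (c, δ) ∈ kummerRelation fun ι => (χ ι).1) :
    (σ, δ) ∈ kummerRelation (fun ι => (χ ι).1) ↔ σ - c ∈ B1 Gal(Ks/K) M := by
  rw [← mem_kummerRelation_zero_iff (T := T) χ hM hχ]
  exact ⟨fun h => by simpa using AddSubgroup.sub_mem _ h hc,
    fun h => by simpa using AddSubgroup.add_mem _ h hc⟩

variable [IsSepClosure K Ks] [Algebra.Etale K T]

theorem exists_isKummerCocycle_of_pow_three_eq_minkowski {θ : Coord K Ks T → Ks} {t : T}
    (h3 : θ ^ 3 = minkowski K Ks T t) (hθ : ∏ ι, θ ι = 1) :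
    ∃ c : Z1 Gal(Ks/K) M, IsKummerCocycle (coordPerm K Ks T) (fun ι => (χ ι).1) θ c := by
  have := Algebra.FormallyUnramified.finite_of_free K T
  refine exists_isKummerCocycle_of_pow_three_mem χ hM hχ
    (isOpen_pointStabilizer_coordPerm K Ks T) ?_ hθ
  rw [h3, ← range_minkowski]
  exact ⟨t, rfl⟩

theorem exists_mk_mem_kummerRelation_of_left [ContinuousSMul Gal(Ks/K) M] (c : Z1 Gal(Ks/K) M) :
    ∃ δ : Additive (NormOne K T), (c, δ) ∈ kummerRelation fun ι => (χ ι).1 := by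
  obtain ⟨θ, hθ, hprod⟩ := exists_isKummerCocycle_prod_eq_one χ hM hχ c
  obtain ⟨δ, hδ⟩ := exists_normOne_minkowski_eq (hM ▸ hθ.pow_card_mem_equivariantFunctions) <| by
    simp only [Pi.pow_apply, Finset.prod_pow, hprod, one_pow]
  exact ⟨.ofMul δ, θ, hδ.symm, hprod, hθ⟩

theorem exists_mk_mem_kummerRelation_of_right [NeZero (3 : Ks)] (δ : Additive (NormOne K T)) :
    ∃ c : Z1 Gal(Ks/K) M, (c, δ) ∈ kummerRelation fun ι => (χ ι).1 := by
  have : IsSepClosed Ks := IsSepClosure.sep_closed K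
  have := nonempty_of_nontrivial_equiv χ hM
  obtain ⟨θ, h3, hprod⟩ := exists_pow_eq_and_prod_eq_one 3
    (prod_minkowski_eq_one (Ks := Ks) δ.toMul)
  obtain ⟨c, hc⟩ := exists_isKummerCocycle_of_pow_three_eq_minkowski χ hM hχ h3 hprod
  exact ⟨c, θ, h3, hprod, hc⟩

theorem exists_H1_addEquiv_normOneModCubes [NeZero (3 : Ks)] [ContinuousSMul Gal(Ks/K) M] :
    ∃ Φ : H1 Gal(Ks/K) M ≃+ Additive (NormOneModCubes K T), ∀ (c : Z1 Gal(Ks/K) M) δ,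
      Φ (QuotientAddGroup.mk c) = .ofMul (QuotientGroup.mk δ) ↔
        (c, .ofMul δ) ∈ kummerRelation fun ι => (χ ι).1 := by
  let cubes := (powMonoidHom 3 : NormOne K T →* NormOne K T).range
  let g : Additive (NormOne K T) →+ Additive (NormOneModCubes K T) :=
    (QuotientGroup.mk' cubes).toAdditive
  have hg : Function.Surjective g := QuotientGroup.mk'_surjective cubes
  have hker (δ : Additive (NormOne K T)) :
      (0, δ) ∈ kummerRelation (fun ι => (χ ι).1) ↔ g δ = 0 :=
    (zero_mem_kummerRelation_iff δ.toMul).trans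
      (QuotientGroup.eq_one_iff (N := cubes) δ.toMul).symm
  obtain ⟨Φ, hΦ⟩ := exists_addEquiv_apply_eq_iff_mem (B' := Additive (NormOneModCubes K T))
    (QuotientAddGroup.mk'_surjective _) hg
    (exists_mk_mem_kummerRelation_of_left χ hM hχ)
    (exists_mk_mem_kummerRelation_of_right χ hM hχ)
    (fun c => (mem_kummerRelation_zero_iff χ hM hχ c).trans (QuotientAddGroup.eq_zero_iff c).symm)
    hker
  exact ⟨Φ, fun c δ => hΦ c (.ofMul δ)⟩

end KummerRelation

section Transport

variable {K Ks X Y : Type*} [Field K] [Field Ks] [Algebra K Ks] {α : Gal(Ks/K) →* Equiv.Perm X}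

/-- The action on `Y` obtained from the action `α` on `X` along a bijection. -/
def transportPerm (w : X ≃ Y) (α : Gal(Ks/K) →* Equiv.Perm X) : Gal(Ks/K) →* Equiv.Perm Y :=
  w.permCongrHom.toMonoidHom.comp α

theorem transportPerm_apply (w : X ≃ Y) (g : Gal(Ks/K)) (x : X) :
    transportPerm w α g (w x) = w (α g x) :=
  congrArg (fun x => w (α g x)) (w.symm_apply_apply x)

theorem mem_equivariantFunctions_transportPerm {w : X ≃ Y} {y : Y → Ks} :
    y ∈ equivariantFunctions (transportPerm w α) ↔ y ∘ w ∈ equivariantFunctions α := by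
  simp only [mem_equivariantFunctions, ← w.forall_congr_right, transportPerm_apply,
    Function.comp_apply]

theorem isOpen_pointStabilizer_transportPerm
    (hα : ∀ x, IsOpen (pointStabilizer α x : Set Gal(Ks/K))) (w : X ≃ Y) (y : Y) :
    IsOpen (pointStabilizer (transportPerm w α) y : Set Gal(Ks/K)) := by
  obtain ⟨x, rfl⟩ := w.surjective y
  convert hα x using 2
  ext g
  rw [mem_pointStabilizer, mem_pointStabilizer, transportPerm_apply, w.apply_eq_iff_eq]

theorem sum_mem_range_algebraMap [IsGalois K Ks] [Fintype X] {y : X → Ks}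
    (hy : y ∈ equivariantFunctions α) : ∑ x, y x ∈ Set.range (algebraMap K Ks) := by
  rw [InfiniteGalois.mem_range_algebraMap_iff_fixed]
  intro g
  rw [map_sum, Finset.sum_congr rfl fun x _ => hy g x, Equiv.sum_comp (α g) y]

end Transport

section CubicAlgebra

variable {K Ks T M : Type*} [Field K] [Field Ks] [Algebra K Ks] [CommRing T] [Algebra K T]

theorem kappa_apply [Fintype (Coord K Ks T)] (θ : Coord K Ks T → Ks) (p : K × T)
    (ω : Omega Ks (Coord K Ks T)) :
    kappa K Ks T θ p ω = algebraMap K Ks p.1 + ∑ ι, ι p.2 * ω.1 ι * θ ι :=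
  congrArg (algebraMap K Ks p.1 + ·) (trace_pi _)

variable [AddCommGroup M] [DistribMulAction Gal(Ks/K) M] [TopologicalSpace M] [DiscreteTopology M]

theorem exists_isLabelling_addRight_trans_iff {L : Type*} [CommRing L] [Algebra K L]
    {c : Z1 Gal(Ks/K) M} {π : M ≃ Coord K Ks L} (hπ : IsLabelling c π) (σ : Z1 Gal(Ks/K) M) :
    (∃ t, IsLabelling σ ((Equiv.addRight t).trans π)) ↔ σ - c ∈ B1 Gal(Ks/K) M := by
  refine exists_congr fun t => forall_congr' fun g => ?_
  have hx (x : M) : galCoord g ((Equiv.addRight t).trans π x)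
      = (Equiv.addRight t).trans π (g • x + σ.1 g) ↔ (σ - c).1 g = g • t - t := by
    have hsub : (σ - c).1 g = σ.1 g - c.1 g := rfl
    simp only [Equiv.trans_apply, Equiv.coe_addRight]
    rw [hπ, π.injective.eq_iff, hsub, smul_add, add_assoc, add_assoc, add_right_inj,
      sub_eq_sub_iff_add_eq_add, eq_comm]
  exact (forall_congr' hx).trans (forall_const M)

variable [Fintype (Coord K Ks T)] [HasEnoughRootsOfUnity Ks (AddMonoid.exponent M)]
  (χ : Coord K Ks T ≃ {ψ : AddChar M Ks // ψ ≠ 0}) (hM : Nat.card M = 3)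
  {θ : Coord K Ks T → Ks} {c : Z1 Gal(Ks/K) M}

theorem kappa_mem_equivariantFunctions (hχ : IsEquivariant (coordPerm K Ks T) fun ι => (χ ι).1)
    (hc : IsKummerCocycle (coordPerm K Ks T) (fun ι => (χ ι).1) θ c) (p : K × T) :
    kappa K Ks T θ p ∈ equivariantFunctions (transportPerm (omegaEquiv χ hM) (affinePerm c)) := by
  rw [mem_equivariantFunctions_transportPerm]
  intro g x
  rw [Function.comp_apply, Function.comp_apply, kappa_apply, kappa_apply, map_add,
    AlgEquiv.commutes, map_sum]
  congr 1
  refine Fintype.sum_equiv (coordPerm K Ks T g) _ _ fun ι => ?_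
  rw [map_mul, map_mul, hc, omegaEquiv_apply, ← hχ, omegaEquiv_apply, affinePerm_apply,
    AddChar.map_add_eq_mul, coordPerm_apply_apply]
  ring

theorem exists_kappa_eq_three_smul [IsSepClosure K Ks] [Algebra.Etale K T]
    (hχ : IsEquivariant (coordPerm K Ks T) fun ι => (χ ι).1) (hθ : ∀ ι, θ ι ≠ 0)
    (hc : IsKummerCocycle (coordPerm K Ks T) (fun ι => (χ ι).1) θ c)
    {y : Omega Ks (Coord K Ks T) → Ks}
    (hy : y ∈ equivariantFunctions (transportPerm (omegaEquiv χ hM) (affinePerm c))) :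
    ∃ p, kappa K Ks T θ p = (3 : K) • y := by
  have : Finite M := Nat.finite_of_card_ne_zero (by lia)
  have := Fintype.ofFinite M
  rw [mem_equivariantFunctions_transportPerm] at hy
  obtain ⟨a, ha⟩ := sum_mem_range_algebraMap hy
  have hdiv := (isKummerCocycle_fourierCoeff hχ c hy).div_mem_equivariantFunctions hc
  rw [← range_minkowski] at hdiv
  obtain ⟨ξ, hξ⟩ := hdiv
  refine ⟨(a, ξ), funext fun ω => ?_⟩
  obtain ⟨x, rfl⟩ := (omegaEquiv χ hM).surjective ω
  have hι (ι : Coord K Ks T) : ι ξ * (χ ι).1 x * θ ι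
      = (χ ι).1 x * fourierCoeff (χ ι).1 (y ∘ omegaEquiv χ hM) := by
    have h : ι ξ = fourierCoeff (χ ι).1 (y ∘ omegaEquiv χ hM) / θ ι := congrFun hξ ι
    rw [mul_right_comm, h, div_mul_cancel₀ _ (hθ ι), mul_comm]
  simp only [kappa_apply, ha, omegaEquiv_apply, hι]
  rw [fourier_inversion, hM, Pi.smul_apply, Algebra.smul_def, map_ofNat, Nat.cast_ofNat,
    Function.comp_apply]

theorem range_kappa [IsSepClosure K Ks] [Algebra.Etale K T] [NeZero (3 : K)]
    (hχ : IsEquivariant (coordPerm K Ks T) fun ι => (χ ι).1) (hθ : ∀ ι, θ ι ≠ 0)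
    (hc : IsKummerCocycle (coordPerm K Ks T) (fun ι => (χ ι).1) θ c) :
    Set.range (kappa K Ks T θ)
      = equivariantFunctions (transportPerm (omegaEquiv χ hM) (affinePerm c)) := by
  refine (Set.range_subset_iff.mpr (kappa_mem_equivariantFunctions χ hM hχ hc)).antisymm
    fun y hy => ?_
  obtain ⟨p, hp⟩ := exists_kappa_eq_three_smul χ hM hχ hθ hc hy
  exact ⟨(3 : K)⁻¹ • p, by rw [map_smul, hp, inv_smul_smul₀ (NeZero.ne _)]⟩

theorem exists_isLabelling_of_isKummerCocycle [IsSepClosure K Ks] [Algebra.Etale K T]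
    [NeZero (3 : K)] [ContinuousSMul Gal(Ks/K) M]
    (hχ : IsEquivariant (coordPerm K Ks T) fun ι => (χ ι).1) (hθ : ∀ ι, θ ι ≠ 0)
    (hc : IsKummerCocycle (coordPerm K Ks T) (fun ι => (χ ι).1) θ c) :
    ∃ L : Subalgebra K (Omega Ks (Coord K Ks T) → Ks),
      (L : Set (Omega Ks (Coord K Ks T) → Ks)) = Set.range (kappa K Ks T θ) ∧
      Algebra.Etale K L ∧ Module.finrank K L = 3 ∧
      ∃ π : M ≃ Coord K Ks L,
        (∀ (x : M) (y : L), π x y = y.1 (omegaEquiv χ hM x)) ∧ IsLabelling c π := by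
  let w := omegaEquiv χ hM
  have : Finite M := Nat.finite_of_card_ne_zero (by lia)
  have : Finite (Omega Ks (Coord K Ks T)) := .of_equiv M w
  have hα := isOpen_pointStabilizer_transportPerm (isOpen_pointStabilizer_affinePerm c) w
  refine ⟨_, (range_kappa χ hM hχ hθ hc).symm, etale_equivariantFunctions hα, ?_,
    w.trans (.ofBijective _ (evalCoord_bijective hα)), fun _ _ => rfl, fun g x => ?_⟩
  · rw [finrank_equivariantFunctions hα, ← Nat.card_congr w, hM]
  · refine AlgHom.ext fun y => (y.2 g (w x)).trans ?_
    rw [transportPerm_apply]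
    rfl

end CubicAlgebra

theorem neZero_three_of_ringChar_ne {K : Type*} [Field K] (h3 : ringChar K ≠ 3) :
    NeZero (3 : K) := by
  refine ⟨fun h => ?_⟩
  have hdvd : ringChar K ∣ 3 := (ringChar.spec K 3).mp (by exact_mod_cast h)
  exact ((Nat.dvd_prime Nat.prime_three).mp hdvd).elim CharP.ringChar_ne_one h3

end KummerCubic

open KummerCubic in
theorem mainTheorem2_general {K Ks M T' : Type*}
    [Field K] [Field Ks] [Algebra K Ks] [IsSepClosure K Ks] (h3 : ringChar K ≠ 3)
    [AddCommGroup M] [TopologicalSpace M] [DiscreteTopology M]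
    [DistribMulAction Gal(Ks/K) M] [ContinuousSMul Gal(Ks/K) M] (hM : Nat.card M = 3)
    [CommRing T'] [Algebra K T'] [Algebra.Etale K T']
    (e : Coord K Ks T' ≃ MaxOrder (TateDual Ks M))
    (he : ∀ (g : Gal(Ks/K)) (ι : Coord K Ks T'), (e (galCoord g ι)).1 = g • (e ι).1) :
    ∃ w : M ≃ Omega Ks (Coord K Ks T'),
      (∀ (x : M) (ι : Coord K Ks T'), (w x).1 ι = (e ι).1.eval x) ∧
      ∃ Φ : H1 Gal(Ks/K) M ≃+ Additive (NormOneModCubes K T'),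
        ∀ δ : NormOne K T',
          (∃ θ : Coord K Ks T' → Ks,
            θ ^ 3 = minkowski K Ks T' ((δ : T'ˣ) : T') ∧ Algebra.norm Ks θ = 1) ∧
          ∀ θ : Coord K Ks T' → Ks,
            θ ^ 3 = minkowski K Ks T' ((δ : T'ˣ) : T') → Algebra.norm Ks θ = 1 →
            ∃ L : Subalgebra K (Omega Ks (Coord K Ks T') → Ks),
              (L : Set (Omega Ks (Coord K Ks T') → Ks)) = Set.range (kappa K Ks T' θ) ∧
              Algebra.Etale K L ∧ Module.finrank K L = 3 ∧
              ∃ π : M ≃ Coord K Ks L,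
                (∀ (x : M) (y : L), π x y = y.1 (w x)) ∧
                ∀ σ : Z1 Gal(Ks/K) M,
                  Φ (QuotientAddGroup.mk σ) = Additive.ofMul (QuotientGroup.mk δ) ↔
                    ∃ t : M, IsLabelling (σ : Gal(Ks/K) → M) ((Equiv.addRight t).trans π) := by
  have : IsSepClosed Ks := IsSepClosure.sep_closed K
  have : NeZero (3 : K) := neZero_three_of_ringChar_ne h3
  have : NeZero (3 : Ks) := neZero_three_of_ringChar_ne (Algebra.ringChar_eq K Ks ▸ h3)
  have : NeZero (Nat.card M : Ks) := by rwa [hM]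
  have : Finite M := Nat.finite_of_card_ne_zero (by lia)
  have := Algebra.FormallyUnramified.finite_of_free K T'
  have := Fintype.ofFinite (Coord K Ks T')
  let χ := e.trans (maxOrderEquivNontrivial (hM ▸ Nat.prime_three))
  have hχ : IsEquivariant (coordPerm K Ks T') fun ι => (χ ι).1 := fun g ι x => by
    change (e (galCoord g ι)).1.eval (g • x) = g ((e ι).1.eval x)
    rw [he, TateDual.eval_smul, inv_smul_smul]
  have := nonempty_of_nontrivial_equiv χ hM
  obtain ⟨Φ, hΦ⟩ := exists_H1_addEquiv_normOneModCubes χ hM hχ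
  refine ⟨omegaEquiv χ hM, fun _ _ => rfl, Φ, fun δ => ⟨?_, fun θ hθ hN => ?_⟩⟩
  · simpa only [norm_pi] using exists_pow_eq_and_prod_eq_one 3 (prod_minkowski_eq_one δ)
  · rw [norm_pi] at hN
    obtain ⟨c, hc⟩ := exists_isKummerCocycle_of_pow_three_eq_minkowski χ hM hχ hθ hN
    obtain ⟨L, hL, hétale, hrank, π, hπ, hlabel⟩ := exists_isLabelling_of_isKummerCocycle χ hM hχ
      (fun ι => Finset.prod_ne_zero_iff.mp (hN ▸ one_ne_zero) ι (Finset.mem_univ ι)) hc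
    have hcδ : (c, .ofMul δ) ∈ kummerRelation fun ι => (χ ι).1 := ⟨θ, hθ, hN, hc⟩
    refine ⟨L, hL, hétale, hrank, π, hπ, fun σ => ?_⟩
    rw [hΦ, mem_kummerRelation_iff_sub_mem_B1 χ hM hχ hcδ,
      exists_isLabelling_addRight_trans_iff hlabel]

open KummerCubic in
theorem mainTheorem2 {K Ks M T' : Type*}
    [Field K] [Field Ks] [Algebra K Ks] [IsSepClosure K Ks]
    (h2 : ringChar K ≠ 2) (h3 : ringChar K ≠ 3)
    [AddCommGroup M] [TopologicalSpace M] [DiscreteTopology M]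
    [DistribMulAction Gal(Ks/K) M] [ContinuousSMul Gal(Ks/K) M] (hM : Nat.card M = 3)
    [CommRing T'] [Algebra K T'] [Algebra.Etale K T']
    (e : Coord K Ks T' ≃ MaxOrder (TateDual Ks M))
    (he : ∀ (g : Gal(Ks/K)) (ι : Coord K Ks T'), (e (galCoord g ι)).1 = g • (e ι).1) :
    ∃ w : M ≃ Omega Ks (Coord K Ks T'),
      (∀ (x : M) (ι : Coord K Ks T'), (w x).1 ι = (e ι).1.eval x) ∧
      ∃ Φ : H1 Gal(Ks/K) M ≃+ Additive (NormOneModCubes K T'),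
        ∀ δ : NormOne K T',
          (∃ θ : Coord K Ks T' → Ks,
            θ ^ 3 = minkowski K Ks T' ((δ : T'ˣ) : T') ∧ Algebra.norm Ks θ = 1) ∧
          ∀ θ : Coord K Ks T' → Ks,
            θ ^ 3 = minkowski K Ks T' ((δ : T'ˣ) : T') → Algebra.norm Ks θ = 1 →
            ∃ L : Subalgebra K (Omega Ks (Coord K Ks T') → Ks),
              (L : Set (Omega Ks (Coord K Ks T') → Ks)) = Set.range (kappa K Ks T' θ) ∧
              Algebra.Etale K L ∧ Module.finrank K L = 3 ∧
              ∃ π : M ≃ Coord K Ks L,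
                (∀ (x : M) (y : L), π x y = y.1 (w x)) ∧
                ∀ σ : Z1 Gal(Ks/K) M,
                  Φ (QuotientAddGroup.mk σ) = Additive.ofMul (QuotientGroup.mk δ) ↔
                    ∃ t : M, IsLabelling (σ : Gal(Ks/K) → M) ((Equiv.addRight t).trans π) :=
  mainTheorem2_general h3 hM e he
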